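/- Let $(W,S)$ be an arbitrary Coxeter system with length function $\ell$, identity $e$, Bruhat order $\le$ and Bruhat covering relation $\lhd$. For $w\in W$ put $\mathrm{Supp}(w)=\{s\in S: s\le w\}$ and let $D_L(w)=\{s\in S:\ell(sw)<\ell(w)\}$, $D_R(w)=\{s\in S:\ell(ws)<\ell(w)\}$ be its sets of left and right descents. For $J\subseteq S$ let $W_J$ be the subgroup generated by $J$, let $W^J=\{w: D_R(w)\cap J=\emptyset\}$ and ${}^JW=\{w: D_L(w)\cap J=\emptyset\}$, and write $w=w^Jw_J={}_Jw\,{}^Jw$ for the factorizations with $w^J\in W^J$, $w_J,{}_Jw\in W_J$, ${}^Jw\in{}^JW$. Let $w_0(H)$ be the longest element of $[e,w]\cap W_H$, and let $C_s$ be the set of the elements of $S$ that commute with $s\in S$. A matching of $x\in W$ is an involution $M$ of $[e,x]$ such that $v\lhd M(v)$ or $M(v)\lhd v$ for all $v\le x$. It is special if $u\lhd v$ and $M(u)\ne v$ imply $M(u)\le M(v)$, for all $u,v\le x$. It is a multiplication matching if it is $u\mapsto ru$ or $u\mapsto ur$ on $[e,x]$ for some $r\in S$. We say that $M$ commutes with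 $\lambda_r$ if $r\in D_L(x)$ and $M(ru)=rM(u)$ for all $u\le x$, and that $M$ commutes with $\rho_r$ if $r\in D_R(x)$ and $M(ur)=M(u)r$ for all $u\le x$. A system for $w$ is a triple $\mathcal S=(J,H,M)$ with $H\subseteq S$, $|H|\in\{1,2\}$, $M$ a matching of $w_0(H)$ and $C_{M(e)}\subseteq J\subseteq S$ such that, with $K=(S\setminus J)\cup C_{M(e)}$: (i) $M$ is a multiplication matching if and only if $|H|=1$; (ii) $w^J\in W_K$; (iii) $|\mathrm{Supp}((w^J)^H)\cap H|\le1$, and $M$ commutes with $\lambda_\alpha$ for each $\alpha\in\mathrm{Supp}((w^J)^H)\cap H$; $|\mathrm{Supp}({}^H({}^Kw))\cap H|\le1$, and $M$ commutes with $\rho_\beta$ for each $\beta\in\mathrm{Supp}({}^H({}^Kw))\cap H$. An $\mathcal S$-factorization of $u\in W$ is a factorization $u=abc$ with $\ell(u)=\ell(a)+\ell(b)+\ell(c)$, $a\in W_K\cap W^H$, $b\in W_H$, $c\in W_J\cap{}^HW$, $|\mathrm{Supp}(a)\cap H|\le1$, $|\mathrm{Supp}(c)\cap H|\le1$, such that $M$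 commutes with $\lambda_\alpha$ for each $\alpha\in\mathrm{Supp}(a)\cap H$ and with $\rho_\beta$ for each $\beta\in\mathrm{Supp}(c)\cap H$. For $u\le w$ put $M_{\mathcal S}(u)=aM(b)c$, where $u=abc$ is an arbitrary $\mathcal S$-factorization of $u$ (one exists, and the value does not depend on its choice). **Theorem.** Let $\mathcal S=(J,H,M)$ be a system for $w\in W$, let $w=abc$ be an $\mathcal S$-factorization of $w$, let $u\le w$, and let $a'\le a$, $b'\le b$, $c'\le c$ be such that $u=a'b'c'$. Assume that (1) $\ell(u)=\ell(a')+\ell(b')+\ell(c')$, or (2) $M_{\mathcal S}$ is a special matching of $w$ and there is $r\in D_L(a)$ with $\ell(ru)=\ell(ra')+\ell(b')+\ell(c')$. Then $M_{\mathcal S}(u)=a'M(b')c'$. -/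

import Mathlib

namespace CoxeterSystem

variable {B W : Type*} [Group W] {N : CoxeterMatrix B} (cs : CoxeterSystem N W)

/-! ### Bruhat order -/

/-- The covering relation `u ◁ v` of the Bruhat order: `u⁻¹ v` is a reflection and
`ℓ(u) = ℓ(v) - 1`. -/
def BruhatCovers (u v : W) : Prop :=
  cs.IsReflection (u⁻¹ * v) ∧ cs.length v = cs.length u + 1

/-- The Bruhat order: the partial order generated by the relation `u ◁ v`. -/
def BruhatLE (u v : W) : Prop :=
  Relation.ReflTransGen cs.BruhatCovers u v

theorem BruhatLE.length_le {cs : CoxeterSystem N W} {u v : W} (h : cs.BruhatLE u v) :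
    cs.length u ≤ cs.length v := by
  induction h with
  | refl => exact le_rfl
  | tail _ h ih => exact ih.trans (by rw [h.2]; exact Nat.le_succ _)

/-- The support `{s ∈ S : s ≤ w}`, as a set of indices of simple reflections. -/
def support (w : W) : Set B :=
  {i | cs.BruhatLE (cs.simple i) w}

/-! ### Parabolic subgroups and minimal coset representatives -/

/-- The parabolic subgroup `W_J`. -/
def parabolic (J : Set B) : Subgroup W :=
  Subgroup.closure (cs.simple '' J)

/-- The set `W^J` of elements without right descents in `J`. -/
def minRightReps (J : Set B) : Set W :=
  {w | ∀ i ∈ J, ¬ cs.IsRightDescent w i}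

/-- The set `^J W` of elements without left descents in `J`. -/
def minLeftReps (J : Set B) : Set W :=
  {w | ∀ i ∈ J, ¬ cs.IsLeftDescent w i}

theorem exists_right_factorization (J : Set B) (w : W) :
    ∃ x ∈ cs.minRightReps J, ∃ y ∈ cs.parabolic J, w = x * y := by
  induction hn : cs.length w using Nat.strong_induction_on generalizing w with
  | _ n ih =>
    by_cases h : w ∈ cs.minRightReps J
    · exact ⟨w, h, 1, one_mem _, by simp⟩
    · simp only [minRightReps, Set.mem_ofPred_eq, not_forall, not_not] at h
      obtain ⟨i, hi, hd⟩ := h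
      obtain ⟨x, hx, y, hy, hxy⟩ := ih _ (hn ▸ hd) (w * cs.simple i) rfl
      refine ⟨x, hx, y * cs.simple i,
        mul_mem hy (Subgroup.subset_closure ⟨i, hi, rfl⟩), ?_⟩
      rw [← mul_assoc, ← hxy, simple_mul_simple_cancel_right]

/-- The element `w^J` of the factorization `w = w^J w_J` with `w^J ∈ W^J` and `w_J ∈ W_J`. -/
noncomputable def rightRep (J : Set B) (w : W) : W :=
  (cs.exists_right_factorization J w).choose

/-- The element `^J w` of the factorization `w = _J w · ^J w` with `_J w ∈ W_J` and
`^J w ∈ ^J W`; equivalently `^J w = ((w⁻¹)^J)⁻¹`. -/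
noncomputable def leftRep (J : Set B) (w : W) : W :=
  (cs.rightRep J w⁻¹)⁻¹

theorem rightRep_spec (J : Set B) (w : W) :
    cs.rightRep J w ∈ cs.minRightReps J ∧ (cs.rightRep J w)⁻¹ * w ∈ cs.parabolic J := by
  obtain ⟨hx, y, hy, hw⟩ := (cs.exists_right_factorization J w).choose_spec
  refine ⟨hx, ?_⟩
  have : (cs.rightRep J w)⁻¹ * w = y := by
    rw [inv_mul_eq_iff_eq_mul]; exact hw
  rwa [this]

theorem leftRep_spec (J : Set B) (w : W) :
    cs.leftRep J w ∈ cs.minLeftReps J ∧ w * (cs.leftRep J w)⁻¹ ∈ cs.parabolic J := by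
  obtain ⟨h₁, h₂⟩ := cs.rightRep_spec J w⁻¹
  refine ⟨fun i hi hd => h₁ i hi ?_, ?_⟩
  · rwa [leftRep, isLeftDescent_inv_iff] at hd
  · simpa [leftRep] using inv_mem h₂

theorem exists_longest (H : Set B) (w : W) :
    ∃ x, (cs.BruhatLE x w ∧ x ∈ cs.parabolic H) ∧
      ∀ y, cs.BruhatLE y w → y ∈ cs.parabolic H → cs.length y ≤ cs.length x := by
  have hone : ∀ (n : ℕ) (w : W), cs.length w = n → cs.BruhatLE 1 w := by
    intro n
    induction n with
    | zero =>
      intro w hw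
      rw [cs.length_eq_zero_iff.1 hw]
      exact Relation.ReflTransGen.refl
    | succ n ih =>
      intro w hw
      have hne : w ≠ 1 := by
        rintro rfl
        simp at hw
      obtain ⟨i, hi⟩ := cs.exists_rightDescent_of_ne_one hne
      have hl := cs.isRightDescent_iff.1 hi
      refine (ih (w * cs.simple i) (by omega)).tail ⟨?_, hl.symm⟩
      simpa [mul_assoc] using cs.isReflection_simple i
  let P : ℕ → Prop := fun n =>
    ∃ x, cs.BruhatLE x w ∧ x ∈ cs.parabolic H ∧ cs.length x = n
  classical
  have hP0 : P 0 := ⟨1, hone _ w rfl, one_mem _, cs.length_one⟩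
  obtain ⟨x, hx, hxH, hxl⟩ := Nat.findGreatest_spec (P := P) (Nat.zero_le (cs.length w)) hP0
  refine ⟨x, ⟨hx, hxH⟩, fun y hy hyH => ?_⟩
  rw [hxl]
  exact Nat.le_findGreatest hy.length_le ⟨y, hy, hyH, rfl⟩

/-- The longest element `w₀(H)` of `[e, w] ∩ W_H`. -/
noncomputable def longest (H : Set B) (w : W) : W :=
  (cs.exists_longest H w).choose

/-! ### Matchings of lower Bruhat intervals

A map of the interval `[e, w]` to itself is represented by a function `M : W → W`; its values
outside `[e, w]` play no role. -/

/-- `M` is a matching of (the Hasse diagram of) the interval `[e, w]`. -/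
def IsMatching (w : W) (M : W → W) : Prop :=
  ∀ v, cs.BruhatLE v w →
    cs.BruhatLE (M v) w ∧ M (M v) = v ∧ (cs.BruhatCovers v (M v) ∨ cs.BruhatCovers (M v) v)

/-- `M` is a special matching of the interval `[e, w]`. -/
def IsSpecialMatching (w : W) (M : W → W) : Prop :=
  cs.IsMatching w M ∧
    ∀ u v, cs.BruhatLE u w → cs.BruhatLE v w → cs.BruhatCovers u v → M u ≠ v →
      cs.BruhatLE (M u) (M v)

/-- `M` agrees on `[e, w]` with a left or right multiplication by a simple reflection. -/
def IsMultiplicationMatching (w : W) (M : W → W) : Prop :=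
  ∃ i, (∀ u, cs.BruhatLE u w → M u = cs.simple i * u) ∨
    (∀ u, cs.BruhatLE u w → M u = u * cs.simple i)

/-- The matching `λ_i` of `[e, w]` is defined (that is, `i` is a left descent of `w`) and `M`
commutes with it on `[e, w]`. -/
def CommutesWithLeft (w : W) (M : W → W) (i : B) : Prop :=
  cs.IsLeftDescent w i ∧ ∀ u, cs.BruhatLE u w → M (cs.simple i * u) = cs.simple i * M u

/-- The matching `ρ_i` of `[e, w]` is defined (that is, `i` is a right descent of `w`) and `M`
commutes with it on `[e, w]`. -/
def CommutesWithRight (w : W) (M : W → W) (i : B) : Prop :=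
  cs.IsRightDescent w i ∧ ∀ u, cs.BruhatLE u w → M (u * cs.simple i) = M u * cs.simple i

/-! ### Systems -/

/-- The set `C_s` of the simple reflections that commute with `s`. -/
def commutingSet (s : W) : Set B :=
  {i | cs.simple i * s = s * cs.simple i}

/-- `J` and `K` are `s`-complementary. -/
def IsComplementary (s : W) (J K : Set B) : Prop :=
  J ∪ K = Set.univ ∧ J ∩ K = cs.commutingSet s

/-- The `s`-complement of a set `J` that contains `C_s`. -/
def complement (s : W) (J : Set B) : Set B :=
  Jᶜ ∪ cs.commutingSet s

theorem isComplementary_iff {s : W} {J K : Set B} (h : cs.commutingSet s ⊆ J) :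
    cs.IsComplementary s J K ↔ K = cs.complement s J := by
  unfold IsComplementary complement
  constructor
  · rintro ⟨h₁, h₂⟩
    ext i
    have a₁ : i ∈ J ∪ K := h₁ ▸ Set.mem_univ i
    have a₂ : i ∈ J ∩ K ↔ i ∈ cs.commutingSet s := by rw [h₂]
    simp only [Set.mem_union, Set.mem_inter_iff, Set.mem_compl_iff] at *
    tauto
  · rintro rfl
    constructor
    · ext i
      simp only [Set.mem_union, Set.mem_compl_iff, Set.mem_univ, iff_true]
      tauto
    · ext i
      have := @h i
      simp only [Set.mem_union, Set.mem_inter_iff, Set.mem_compl_iff]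
      tauto

/-- A system `(J, H, M)` for `w`. Since `M` is a matching of `[e, w₀(H)]`, the element `M(e)` is a
simple reflection in `H`. -/
structure MatchingSystem (w : W) where
  J : Set B
  H : Set B
  M : W → W
  card_H : H.encard = 1 ∨ H.encard = 2
  isMatching : cs.IsMatching (cs.longest H w) M
  commutingSet_subset : cs.commutingSet (M 1) ⊆ J
  multiplication_iff : cs.IsMultiplicationMatching (cs.longest H w) M ↔ H.encard = 1
  rightRep_mem : cs.rightRep J w ∈ cs.parabolic (cs.complement (M 1) J)
  left_card : (cs.support (cs.rightRep H (cs.rightRep J w)) ∩ H).encard ≤ 1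
  left_commutes : ∀ α ∈ cs.support (cs.rightRep H (cs.rightRep J w)) ∩ H,
    cs.CommutesWithLeft (cs.longest H w) M α
  right_card :
    (cs.support (cs.leftRep H (cs.leftRep (cs.complement (M 1) J) w)) ∩ H).encard ≤ 1
  right_commutes : ∀ β ∈ cs.support (cs.leftRep H (cs.leftRep (cs.complement (M 1) J) w)) ∩ H,
    cs.CommutesWithRight (cs.longest H w) M β

/-- `u = a · b · c`: a factorization with `ℓ(u) = ℓ(a) + ℓ(b) + ℓ(c)`. -/
def IsLengthAdditive (u a b c : W) : Prop :=
  u = a * b * c ∧ cs.length u = cs.length a + cs.length b + cs.length c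

namespace MatchingSystem

variable {cs} {w : W} (𝒮 : cs.MatchingSystem w)

/-- The `M(e)`-complement of `J`. -/
def K : Set B :=
  cs.complement (𝒮.M 1) 𝒮.J

/-- `u = a · b · c` is an `𝒮`-factorization of `u`. -/
structure IsFactorization (u a b c : W) : Prop where
  lengthAdditive : cs.IsLengthAdditive u a b c
  left_mem : a ∈ cs.parabolic 𝒮.K ∧ a ∈ cs.minRightReps 𝒮.H
  left_card : (cs.support a ∩ 𝒮.H).encard ≤ 1
  left_commutes : ∀ α ∈ cs.support a ∩ 𝒮.H,
    cs.CommutesWithLeft (cs.longest 𝒮.H w) 𝒮.M α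
  middle_mem : b ∈ cs.parabolic 𝒮.H
  right_mem : c ∈ cs.parabolic 𝒮.J ∧ c ∈ cs.minLeftReps 𝒮.H
  right_card : (cs.support c ∩ 𝒮.H).encard ≤ 1
  right_commutes : ∀ β ∈ cs.support c ∩ 𝒮.H,
    cs.CommutesWithRight (cs.longest 𝒮.H w) 𝒮.M β

open Classical in
/-- The map `M_𝒮`: `M_𝒮(u) = a M(b) c`, where `u = a · b · c` is an arbitrary `𝒮`-factorization of
`u`. (Every `u ≤ w` has one; an element that has none is sent to itself.) -/
noncomputable def map (u : W) : W :=
  if h : ∃ p : W × W × W, 𝒮.IsFactorization u p.1 p.2.1 p.2.2 then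
    h.choose.1 * 𝒮.M h.choose.2.1 * h.choose.2.2
  else u

end MatchingSystem

end CoxeterSystem

namespace CoxeterSystem

variable {B W : Type*} [Group W] {N : CoxeterMatrix B} (cs : CoxeterSystem N W)

/-! ### The inversion cocycle and the strong exchange property -/

/-! The value `a * M b * c` depends only on the product `a * b * c`, as long as the outer factors
range over suitable parabolic subgroups and the middle one over `[e, w₀(H)]`; lengths of the
factorizations do not enter. Both cases of the theorem then compare the factorization `u = a' * b' *
c'` with the `𝒮`-factorization that defines `𝒮.map u`.

Write `H = {s, t}` with `s = M(e)` (`t = s` when `|H| = 1`). Given `a₁ b₁ c₁ = a₂ b₂ c₂`, put `g =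
a₂⁻¹ a₁` and `h = c₂ c₁⁻¹`. Then `g b₁ = b₂ h`, and the claim is `g M(b₁) = M(b₂) h`
(`mul_map_eq_map_mul`). In the main case `g` lies in `W_J ∩ W_K = W_{J ∩ K}`, so its letters commute
with `s`. Letters in `H` are absorbed into `b₁` and `b₂`, because `M` commutes with the
corresponding multiplications. What remains is `g x₁ = x₂ h` with `g` free of letters of `H` and
with `x₁, x₂` minimal in their right cosets. Bruhat comparison gives `x₁ = x₂` (`eq_of_mul_eq_mul`),
and either `x₁` is `e` or `s`, which `M` exchanges, or `g` commutes with all of `W_H`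
(`eq_one_or_eq_simple_or_commute`).

The Coxeter theory behind this is the inversion cocycle, which yields strong exchange, the lifting
property, parabolic intersections and coset representatives, together with the existence of a
maximum of `[e, w] ∩ W_H`. -/

open Classical in
/-- The permutation `(x, ε) ↦ (s x s, ε + [x = s])` of `W × ZMod 2` attached to a simple
reflection `s`. -/
noncomputable def simplePerm (i : B) : Equiv.Perm (W × ZMod 2) :=
  Function.Involutive.toPerm
    (fun p => (cs.simple i * p.1 * cs.simple i, p.2 + if p.1 = cs.simple i then 1 else 0)) (by
      rintro ⟨x, ε⟩
      have h : cs.simple i * x * cs.simple i = cs.simple i ↔ x = cs.simple i := by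
        constructor
        · intro h
          have := congrArg (fun y => cs.simple i * y * cs.simple i) h
          simpa [mul_assoc] using this
        · rintro rfl
          simp
      ext
      · simp [mul_assoc]
      · simp only [h, add_assoc, CharTwo.add_self_eq_zero, add_zero])

open Classical in
theorem simplePerm_apply (i : B) (x : W) (ε : ZMod 2) :
    cs.simplePerm i (x, ε) =
      (cs.simple i * x * cs.simple i, ε + if x = cs.simple i then 1 else 0) := rfl

-- The reflections met along the alternating word of length `2k` are the elements `s_j (s_i s_j)^l`
-- with `l < 2k`; the second coordinate counts modulo 2 how often `x` is among them.
open Classical in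
theorem simplePerm_mul_pow_apply (i j : B) (k : ℕ) (x : W) (ε : ZMod 2) :
    ((cs.simplePerm i * cs.simplePerm j) ^ k) (x, ε) =
      ((cs.simple i * cs.simple j) ^ k * x * ((cs.simple i * cs.simple j) ^ k)⁻¹,
        ε + ∑ l ∈ Finset.range (2 * k),
          if x = cs.simple j * (cs.simple i * cs.simple j) ^ l then 1 else 0) := by
  induction k with
  | zero => simp
  | succ k ih =>
    set c := cs.simple i * cs.simple j with hc
    have hinv : ∀ l : ℕ, (c ^ l)⁻¹ * cs.simple j = cs.simple j * c ^ l := by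
      intro l
      have h : SemiconjBy (cs.simple j) c c⁻¹ := by
        simp [SemiconjBy, hc, mul_assoc]
      have := (h.pow_right l).eq
      rw [this, inv_pow]
    have h1 : c ^ k * x * (c ^ k)⁻¹ = cs.simple j ↔ x = cs.simple j * c ^ (2 * k) := by
      rw [mul_inv_eq_iff_eq_mul, ← eq_inv_mul_iff_mul_eq, ← mul_assoc, hinv, mul_assoc, ← pow_add,
        two_mul]
    have h2 : cs.simple j * (c ^ k * x * (c ^ k)⁻¹) * cs.simple j = cs.simple i ↔
        x = cs.simple j * c ^ (2 * k + 1) := by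
      have e : cs.simple j * c ^ (2 * k + 1) =
          (c ^ k)⁻¹ * (cs.simple j * cs.simple i * cs.simple j) * c ^ k := by
        rw [← mul_assoc, ← mul_assoc, hinv, pow_succ, two_mul, pow_add]
        have : c ^ k * c ^ k * c = c ^ k * c * c ^ k := by
          rw [mul_assoc, mul_assoc, ← pow_succ, ← pow_succ']
        rw [this, hc]
        simp only [mul_assoc]
      rw [e]
      constructor
      · intro h
        rw [← h]
        simp [mul_assoc]
      · rintro rfl
        simp [mul_assoc]
    rw [pow_succ', Equiv.Perm.mul_apply, ih, Equiv.Perm.mul_apply, simplePerm_apply,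
      simplePerm_apply]
    ext
    · simp [pow_succ', hc, mul_assoc]
    · simp only [h1, h2]
      rw [show 2 * (k + 1) = 2 * k + 1 + 1 by ring, Finset.sum_range_succ, Finset.sum_range_succ]
      ring

theorem isLiftable_simplePerm : N.IsLiftable cs.simplePerm := by
  classical
  intro i j
  ext1 ⟨x, ε⟩
  -- For `k = N i j` the terms `l` and `l + k` coincide, since `(s_i s_j)^k = 1`, so the two halves
  -- of the sum cancel modulo 2.
  rw [simplePerm_mul_pow_apply, two_mul, Finset.sum_range_add]
  have hc := cs.simple_mul_simple_pow i j
  simp only [pow_add, hc, one_mul, CharTwo.add_self_eq_zero]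
  simp

/-- The action of `W` on `W × ZMod 2` that extends `simplePerm`. -/
noncomputable def inversionRep : W →* Equiv.Perm (W × ZMod 2) :=
  cs.lift ⟨cs.simplePerm, cs.isLiftable_simplePerm⟩

/-- The parity of the number of occurrences of `x` in the right inversion sequence of a word
for `w`. -/
noncomputable def inversionParity (w x : W) : ZMod 2 :=
  (cs.inversionRep w (x, 0)).2

theorem inversionRep_apply (w x : W) (ε : ZMod 2) :
    cs.inversionRep w (x, ε) = (w * x * w⁻¹, ε + cs.inversionParity w x) := by
  induction w using cs.simple_induction_left generalizing x ε with
  | one => simp [inversionParity]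
  | mul_simple_left w i ih =>
    have h : cs.inversionRep (cs.simple i) = cs.simplePerm i :=
      cs.lift_apply_simple cs.isLiftable_simplePerm i
    have key : ∀ ε, cs.inversionRep (cs.simple i * w) (x, ε) =
        (cs.simple i * (w * x * w⁻¹) * cs.simple i, ε + cs.inversionParity w x +
          (cs.simplePerm i (w * x * w⁻¹, 0)).2) := by
      intro ε
      rw [map_mul, Equiv.Perm.mul_apply, ih, h, simplePerm_apply, simplePerm_apply, zero_add]
    rw [inversionParity, key, key]
    simp [mul_assoc, add_assoc]

theorem inversionParity_mul (u v x : W) :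
    cs.inversionParity (u * v) x =
      cs.inversionParity v x + cs.inversionParity u (v * x * v⁻¹) := by
  conv_lhs => rw [inversionParity, map_mul, Equiv.Perm.mul_apply, inversionRep_apply,
    inversionRep_apply]
  simp

open Classical in
theorem inversionParity_simple (i : B) (x : W) :
    cs.inversionParity (cs.simple i) x = if x = cs.simple i then 1 else 0 := by
  rw [inversionParity, inversionRep, cs.lift_apply_simple cs.isLiftable_simplePerm,
    simplePerm_apply, zero_add]

theorem inversionParity_one (x : W) : cs.inversionParity 1 x = 0 := by
  simp [inversionParity]

theorem mem_rightInvSeq_of_inversionParity_ne_zero (ω : List B) {x : W}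
    (h : cs.inversionParity (cs.wordProd ω) x ≠ 0) : x ∈ cs.rightInvSeq ω := by
  classical
  induction ω with
  | nil => simp [inversionParity_one] at h
  | cons i ω ih =>
    rw [rightInvSeq, List.mem_cons]
    by_cases h0 : cs.inversionParity (cs.wordProd ω) x = 0
    · left
      rw [wordProd_cons, inversionParity_mul, h0, zero_add, inversionParity_simple] at h
      have : cs.wordProd ω * x * (cs.wordProd ω)⁻¹ = cs.simple i := by
        by_contra hne
        simp [hne] at h
      rw [← this]
      simp [mul_assoc]
    · exact Or.inr (ih h0)

theorem IsReflection.inversionParity_self {t : W} (ht : cs.IsReflection t) :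
    cs.inversionParity t t = 1 := by
  obtain ⟨u, i, rfl⟩ := ht
  have h := cs.inversionParity_mul u u⁻¹ (u * cs.simple i * u⁻¹)
  have e : u⁻¹ * (u * cs.simple i * u⁻¹) * u⁻¹⁻¹ = cs.simple i := by simp [mul_assoc]
  rw [mul_inv_cancel, inversionParity_one, e] at h
  rw [inversionParity_mul, e, inversionParity_mul, inversionParity_simple, if_pos rfl]
  simp only [inv_simple, simple_mul_simple_self, one_mul]
  linear_combination -h

theorem IsReflection.isRightInversion_iff {t : W} (ht : cs.IsReflection t) (w : W) :
    cs.IsRightInversion w t ↔ cs.inversionParity w t = 1 := by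
  have key : ∀ w, cs.inversionParity w t ≠ 0 → cs.IsRightInversion w t := by
    intro w h
    obtain ⟨ω, hω, rfl⟩ := cs.exists_isReduced w
    exact cs.isRightInversion_of_mem_rightInvSeq hω
      (cs.mem_rightInvSeq_of_inversionParity_ne_zero ω h)
  constructor
  · intro h
    by_contra h1
    have h0 : cs.inversionParity w t = 0 := by
      generalize cs.inversionParity w t = z at h1
      revert z
      decide
    -- Right multiplication by `t` flips the parity at `t`, so parity 0 at `w` would make `t` an
    -- inversion of `w * t` as well as of `w`.
    refine (ht.isRightInversion_mul_left_iff.1 (key (w * t) ?_)) h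
    rw [inversionParity_mul, ht.inversionParity_self, mul_inv_cancel_right, h0]
    decide
  · intro h
    exact key w (by rw [h]; exact one_ne_zero)

/-- The cocycle property of right inversions. -/
theorem IsReflection.isRightInversion_mul {t : W} (ht : cs.IsReflection t) (x y : W) :
    cs.IsRightInversion (x * y) t ↔
      (cs.IsRightInversion y t ↔ ¬ cs.IsRightInversion x (y * t * y⁻¹)) := by
  rw [ht.isRightInversion_iff, ht.isRightInversion_iff, (ht.conj y).isRightInversion_iff,
    inversionParity_mul]
  generalize cs.inversionParity y t = a
  generalize cs.inversionParity x (y * t * y⁻¹) = b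
  revert a b
  decide

theorem isRightInversion_simple_iff {t : W} (i : B) :
    cs.IsRightInversion (cs.simple i) t ↔ t = cs.simple i := by
  constructor
  · rintro ⟨ht, hl⟩
    rw [length_simple, Nat.lt_one_iff, length_eq_zero_iff] at hl
    rw [← ht.inv, ← mul_eq_one_iff_eq_inv.1 hl]
  · rintro rfl
    exact ⟨cs.isReflection_simple i, by simp⟩

/-! ### The geometric representation and injectivity of `simple` -/

section geometric

open Module Polynomial.Chebyshev Real

/-- The product acts as a rotation by `θ = 2π / m`. The coefficients of its powers are Chebyshev
values `S n (2 cos θ) = sin ((n + 1) θ) / sin θ`, and the relevant ones vanish because `m θ = 2π`.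
-/
theorem _root_.Module.reflection_mul_reflection_pow_eq_one {V : Type*} [AddCommGroup V]
    [Module ℝ V] {x y : V} {f g : Dual ℝ V} (hf : f x = 2) (hg : g y = 2) {m : ℕ} (hm : 2 ≤ m)
    (hfy : f y = -2 * cos (π / m)) (hgx : g x = -2 * cos (π / m)) :
    (reflection hf * reflection hg) ^ m = 1 := by
  ext z
  rw [reflection_mul_reflection_pow_apply hf hg m z]
  -- For `m = 2` one has `sin θ = 0`, so division by it is excluded and the two reflections are
  -- handled directly.
  rcases hm.eq_or_lt with rfl | hm
  · have h0 : cos (π / (2 : ℕ)) = 0 := by simp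
    rw [h0] at hfy hgx
    norm_num [hfy, hgx]
    match_scalars <;> ring
  have hm0 : (0 : ℝ) < m := by positivity
  set θ : ℝ := 2 * π / m with hθ
  have ht : f y * g x - 2 = 2 * cos θ := by
    rw [hfy, hgx, hθ, mul_div_assoc, cos_two_mul]
    ring
  rw [ht]
  have hsin : sin θ ≠ 0 := by
    refine (sin_pos_of_pos_of_lt_pi (by positivity) ?_).ne'
    rw [hθ, div_lt_iff₀ hm0]
    have : (3 : ℝ) ≤ m := by exact_mod_cast hm
    nlinarith [pi_pos]
  have hmθ : m * θ = 2 * π := by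
    rw [hθ]
    field_simp
  have hS := S_two_mul_real_cos θ
  rcases Nat.even_or_odd' m with ⟨k, rfl | rfl⟩
  · have e1 : (((2 * k : ℕ) : ℤ) - 2) / 2 = k - 1 := by omega
    have e2 : (((2 * k : ℕ) : ℤ) - 1) / 2 = k - 1 := by omega
    have hz : (S ℝ (k - 1)).eval (2 * cos θ) = 0 := by
      have h1 := hS (k - 1)
      have : (((k - 1 : ℤ) : ℝ) + 1) * θ = π := by
        push_cast at hmθ ⊢
        linarith
      rw [this, sin_pi] at h1
      exact (mul_eq_zero.1 h1).resolve_right hsin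
    rw [e1, e2, hz]
    simp
  · have e1 : (((2 * k + 1 : ℕ) : ℤ) - 2) / 2 = k - 1 := by omega
    have e2 : (((2 * k + 1 : ℕ) : ℤ) - 1) / 2 = k := by omega
    have e3 : (((2 * k + 1 : ℕ) : ℤ) - 3) / 2 = k - 1 := by omega
    have e4 : ((2 * k + 1 : ℕ) : ℤ) / 2 = k := by omega
    have hz : (S ℝ k).eval (2 * cos θ) + (S ℝ (k - 1)).eval (2 * cos θ) = 0 := by
      have h1 := hS (k - 1)
      have h2 := hS k
      have a1 : (((k - 1 : ℤ) : ℝ) + 1) * θ = k * θ := by push_cast; ring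
      have a2 : (((k : ℤ) : ℝ) + 1) * θ = 2 * π - k * θ := by
        push_cast at hmθ ⊢
        linarith
      rw [a1] at h1
      rw [a2, sin_two_pi_sub] at h2
      have : ((S ℝ k).eval (2 * cos θ) + (S ℝ (k - 1)).eval (2 * cos θ)) * sin θ = 0 := by
        linarith
      exact (mul_eq_zero.1 this).resolve_right hsin
    rw [e1, e2, e3, e4, hz]
    simp

/-- The simple coroot, as a linear form on the space with basis the simple roots. -/
noncomputable def _root_.CoxeterMatrix.coroot (N : CoxeterMatrix B) (i : B) : Dual ℝ (B →₀ ℝ) :=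
  -- An infinite order is encoded by `N i j = 0`; then `π / 0 = 0` gives the value `-2`.
  Finsupp.linearCombination ℝ fun j => -2 * cos (π / N i j)

theorem _root_.CoxeterMatrix.coroot_single (N : CoxeterMatrix B) (i j : B) :
    N.coroot i (Finsupp.single j 1) = -2 * cos (π / N i j) := by
  simp [CoxeterMatrix.coroot]

theorem _root_.CoxeterMatrix.coroot_single_self (N : CoxeterMatrix B) (i : B) :
    N.coroot i (Finsupp.single i 1) = 2 := by
  simp [CoxeterMatrix.coroot_single]

theorem isLiftable_reflection (N : CoxeterMatrix B) :
    N.IsLiftable fun i => reflection (N.coroot_single_self i) := by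
  intro i j
  by_cases hij : i = j
  · subst hij
    rw [CoxeterMatrix.diagonal, pow_one, mul_eq_one_iff_eq_inv, reflection_inv]
  · by_cases h0 : N i j = 0
    · rw [h0, pow_zero]
    · refine reflection_mul_reflection_pow_eq_one _ _ ?_ (N.coroot_single i j) ?_
      · have := N.off_diagonal i j hij
        omega
      · rw [N.symmetric i j]
        exact N.coroot_single j i

/-- In the geometric representation `s_i` negates the `i`-th simple root, while `s_j` with `j ≠ i`
fixes its `i`-th coordinate. -/
theorem simple_injective : Function.Injective cs.simple := by
  intro i j h
  by_contra hij
  have h1 := cs.lift_apply_simple (isLiftable_reflection N) i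
  rw [h, cs.lift_apply_simple (isLiftable_reflection N) j] at h1
  have h2 := congrArg (fun e : (B →₀ ℝ) ≃ₗ[ℝ] (B →₀ ℝ) => e (Finsupp.single i 1) i) h1
  simp only [reflection_apply, CoxeterMatrix.coroot_single_self, Finsupp.sub_apply,
    Finsupp.smul_apply, Finsupp.single_eq_same] at h2
  rw [Finsupp.single_eq_of_ne hij] at h2
  norm_num at h2

end geometric

/-! ### Bruhat order and the lifting property -/

variable {cs}

theorem BruhatLE.refl (u : W) : cs.BruhatLE u u := Relation.ReflTransGen.refl

theorem BruhatLE.trans {u v w : W} (h : cs.BruhatLE u v) (h' : cs.BruhatLE v w) :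
    cs.BruhatLE u w := Relation.ReflTransGen.trans h h'

theorem BruhatCovers.le {u v : W} (h : cs.BruhatCovers u v) : cs.BruhatLE u v :=
  Relation.ReflTransGen.single h

theorem BruhatLE.eq_of_length_le {u v : W} (h : cs.BruhatLE u v)
    (hl : cs.length v ≤ cs.length u) : u = v := by
  rcases Relation.ReflTransGen.cases_tail h with rfl | ⟨z, hz, hzv⟩
  · rfl
  · have h1 := BruhatLE.length_le hz
    have h2 := hzv.2
    omega

theorem BruhatLE.antisymm {u v : W} (h : cs.BruhatLE u v) (h' : cs.BruhatLE v u) : u = v :=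
  h.eq_of_length_le h'.length_le

theorem BruhatCovers.inv {u v : W} (h : cs.BruhatCovers u v) : cs.BruhatCovers u⁻¹ v⁻¹ := by
  refine ⟨?_, by rw [length_inv, length_inv, h.2]⟩
  have h1 := (h.1.conj u).inv
  have h2 := h.1.conj u
  rw [← h1] at h2
  simpa [mul_assoc] using h2

theorem BruhatLE.inv {u v : W} (h : cs.BruhatLE u v) : cs.BruhatLE u⁻¹ v⁻¹ := by
  induction h with
  | refl => exact BruhatLE.refl _
  | tail _ h ih => exact ih.trans h.inv.le

theorem bruhatCovers_simple_mul {w : W} {i : B} (h : cs.length (cs.simple i * w) = cs.length w + 1) :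
    cs.BruhatCovers w (cs.simple i * w) := by
  refine ⟨?_, h⟩
  simpa [mul_assoc] using (cs.isReflection_simple i).conj w⁻¹

theorem bruhatLE_simple_mul {w : W} {i : B} (h : ¬ cs.IsLeftDescent w i) :
    cs.BruhatLE w (cs.simple i * w) :=
  (bruhatCovers_simple_mul (cs.not_isLeftDescent_iff.1 h)).le

theorem IsLeftDescent.simple_mul_le {w : W} {i : B} (h : cs.IsLeftDescent w i) :
    cs.BruhatLE (cs.simple i * w) w := by
  have := bruhatLE_simple_mul (cs.isLeftDescent_iff_not_isLeftDescent_mul.1 h)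
  rwa [simple_mul_simple_cancel_left] at this

/-- Let `y = x t`. By the cocycle, `t` becomes an inversion of `s x` only if `x t x⁻¹ = s`, that is
`s x = y`. Otherwise `s x` stays shorter than `s y`. -/
theorem BruhatCovers.simple_mul {x y : W} (h : cs.BruhatCovers x y) (i : B) :
    cs.simple i * x = y ∨ cs.BruhatLE (cs.simple i * x) (cs.simple i * y) := by
  by_cases hxy : cs.simple i * x = y
  · exact Or.inl hxy
  right
  obtain ⟨ht, hl⟩ := h
  set t := x⁻¹ * y with htdef
  have hy : y = x * t := by simp [htdef]
  have hxt : ¬ cs.IsRightInversion x t := by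
    rintro ⟨-, h⟩
    rw [← hy] at h
    omega
  have hs : ¬ cs.IsRightInversion (cs.simple i) (x * t * x⁻¹) := by
    rw [isRightInversion_simple_iff, mul_inv_eq_iff_eq_mul]
    intro h
    exact hxy (by rw [hy, h])
  have hn : ¬ cs.IsRightInversion (cs.simple i * x) t := by
    rw [ht.isRightInversion_mul]
    tauto
  have hlt : cs.length (cs.simple i * x) < cs.length (cs.simple i * y) := by
    have h1 := ht.length_mul_left_ne (cs.simple i * x)
    have h2 : ¬ cs.length (cs.simple i * x * t) < cs.length (cs.simple i * x) :=
      fun h => hn ⟨ht, h⟩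
    rw [hy, ← mul_assoc]
    omega
  rcases cs.length_simple_mul x i with hx | hx <;> rcases cs.length_simple_mul y i with hy' | hy'
  · exact BruhatCovers.le ⟨by simpa [mul_assoc] using ht, by omega⟩
  · omega
  · exact (IsLeftDescent.simple_mul_le (by rw [isLeftDescent_iff]; exact hx)).trans
      ((BruhatCovers.le ⟨ht, hl⟩).trans (bruhatCovers_simple_mul hy').le)
  · exact BruhatCovers.le ⟨by simpa [mul_assoc] using ht, by omega⟩

/-- With a common bound `m` for `y` and `s * y`, both alternatives of `BruhatCovers.simple_mul` pass
along a chain of covers without a case split on descents. -/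
theorem BruhatLE.simple_mul_le_of_le {x y m : W} {i : B} (h : cs.BruhatLE x y)
    (hy : cs.BruhatLE y m) (hsy : cs.BruhatLE (cs.simple i * y) m) :
    cs.BruhatLE (cs.simple i * x) m := by
  induction h with
  | refl => exact hsy
  | tail _ hzy ih =>
    refine ih (hzy.le.trans hy) ?_
    rcases hzy.simple_mul i with h | h
    · rwa [h]
    · exact h.trans hsy

theorem BruhatLE.le_simple_mul_of_le {x y m : W} {i : B} (h : cs.BruhatLE x y)
    (hx : cs.BruhatLE m x) (hsx : cs.BruhatLE m (cs.simple i * x)) :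
    cs.BruhatLE m (cs.simple i * y) := by
  induction h with
  | refl => exact hsx
  | tail hxz hzy ih =>
    rcases hzy.simple_mul i with h | h
    · rw [← h, simple_mul_simple_cancel_left]
      exact hx.trans hxz
    · exact ih.trans h

/-- The lifting property. -/
theorem BruhatLE.simple_mul_le {u w : W} {i : B} (h : cs.BruhatLE u w)
    (hw : cs.IsLeftDescent w i) : cs.BruhatLE (cs.simple i * u) w :=
  h.simple_mul_le_of_le (BruhatLE.refl w) hw.simple_mul_le

theorem BruhatLE.mul_simple_le {u w : W} {i : B} (h : cs.BruhatLE u w)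
    (hw : cs.IsRightDescent w i) : cs.BruhatLE (u * cs.simple i) w := by
  have := (h.inv.simple_mul_le (cs.isLeftDescent_inv_iff.2 hw)).inv
  simpa using this

theorem bruhatLE_mul_left {x y : W} (h : cs.length (x * y) = cs.length x + cs.length y) :
    cs.BruhatLE y (x * y) := by
  induction hn : cs.length x generalizing x with
  | zero =>
    rw [length_eq_zero_iff] at hn
    rw [hn, one_mul]
    exact BruhatLE.refl y
  | succ n ih =>
    have hne : x ≠ 1 := by
      rintro rfl
      simp at hn
    obtain ⟨i, hi⟩ := cs.exists_leftDescent_of_ne_one hne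
    rw [isLeftDescent_iff] at hi
    have h1 := cs.length_mul_le (cs.simple i * x) y
    have h2 := cs.length_simple_mul (x * y) i
    rw [← mul_assoc] at h2
    refine (ih (x := cs.simple i * x) (by omega) (by omega)).trans ?_
    rw [mul_assoc]
    apply IsLeftDescent.simple_mul_le
    rw [isLeftDescent_iff, ← mul_assoc]
    omega

theorem bruhatLE_mul_right {x y : W} (h : cs.length (x * y) = cs.length x + cs.length y) :
    cs.BruhatLE x (x * y) := by
  have h' : cs.length (y⁻¹ * x⁻¹) = cs.length y⁻¹ + cs.length x⁻¹ := by
    rw [← mul_inv_rev, length_inv, length_inv, length_inv, h, add_comm]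
  simpa using (bruhatLE_mul_left h').inv

variable (cs) in
theorem one_bruhatLE (w : W) : cs.BruhatLE 1 w := by
  simpa using bruhatLE_mul_right (cs := cs) (x := 1) (y := w) (by simp)

theorem IsLeftDescent.simple_le {w : W} {i : B} (h : cs.IsLeftDescent w i) :
    cs.BruhatLE (cs.simple i) w := by
  simpa using (cs.one_bruhatLE w).simple_mul_le h

/-! ### Parabolic subgroups -/

theorem simple_mem_parabolic {J : Set B} {i : B} (hi : i ∈ J) : cs.simple i ∈ cs.parabolic J :=
  Subgroup.subset_closure ⟨i, hi, rfl⟩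

theorem parabolic_mono {J K : Set B} (h : J ⊆ K) : cs.parabolic J ≤ cs.parabolic K :=
  Subgroup.closure_mono (Set.image_mono h)

theorem parabolic_induction_right {J : Set B} {p : W → Prop} {x : W} (hx : x ∈ cs.parabolic J)
    (one : p 1) (mul : ∀ x ∈ cs.parabolic J, ∀ i ∈ J, p x → p (x * cs.simple i)) : p x := by
  induction hx using Subgroup.closure_induction_right with
  | one => exact one
  | mul_right x hx y hy ih =>
    obtain ⟨i, hi, rfl⟩ := hy
    exact mul x hx i hi ih
  | mul_inv_cancel x hx y hy ih =>
    obtain ⟨i, hi, rfl⟩ := hy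
    rw [inv_simple]
    exact mul x hx i hi ih

theorem parabolic_induction_left {J : Set B} {p : W → Prop} {x : W} (hx : x ∈ cs.parabolic J)
    (one : p 1) (mul : ∀ x ∈ cs.parabolic J, ∀ i ∈ J, p x → p (cs.simple i * x)) : p x := by
  have : p (x⁻¹)⁻¹ := parabolic_induction_right (p := fun y => p y⁻¹) (inv_mem hx) (by simpa)
    (fun y hy i hi h => by simpa using mul _ (inv_mem hy) i hi h)
  simpa using this

/-- Letters of `J` are appended one at a time; when the length drops, strong exchange deletes a
letter instead, so no letter outside `J` appears. -/
theorem exists_isReduced_of_mem_parabolic {J : Set B} {x : W} (hx : x ∈ cs.parabolic J) :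
    ∃ ω : List B, (∀ i ∈ ω, i ∈ J) ∧ cs.IsReduced ω ∧ cs.wordProd ω = x := by
  refine parabolic_induction_right (p := fun x => ∃ ω : List B, (∀ i ∈ ω, i ∈ J) ∧
    cs.IsReduced ω ∧ cs.wordProd ω = x) hx ⟨[], by simp, by simp [IsReduced], by simp⟩ ?_
  · rintro _ - i hi ⟨ω, hJ, hr, rfl⟩
    by_cases h : cs.IsRightDescent (cs.wordProd ω) i
    · have h1 := (cs.isReflection_simple i).isRightInversion_iff cs (cs.wordProd ω)
      rw [isRightInversion_simple_iff_isRightDescent] at h1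
      have h2 := cs.mem_rightInvSeq_of_inversionParity_ne_zero ω
        (by rw [h1.1 h]; exact one_ne_zero)
      obtain ⟨j, hj, he⟩ := List.mem_iff_getElem.1 h2
      have h3 := cs.wordProd_mul_getD_rightInvSeq ω j
      rw [List.getD_eq_getElem _ 1 hj, he] at h3
      rw [length_rightInvSeq] at hj
      refine ⟨ω.eraseIdx j, fun k hk => hJ k (List.mem_of_mem_eraseIdx hk), ?_, h3.symm⟩
      have h4 := List.length_eraseIdx_add_one hj
      have h5 := cs.isRightDescent_iff.1 h
      have h6 := hr.eq
      rw [IsReduced, ← h3]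
      omega
    · refine ⟨ω ++ [i], ?_, ?_, ?_⟩
      · simpa [or_imp, forall_and] using ⟨hJ, hi⟩
      · have h5 := cs.not_isRightDescent_iff.1 h
        have h6 := hr.eq
        rw [IsReduced, wordProd_append, wordProd_singleton, h5, h6]
        simp
      · rw [wordProd_append, wordProd_singleton]

theorem simple_mem_parabolic_iff {J : Set B} {i : B} :
    cs.simple i ∈ cs.parabolic J ↔ i ∈ J := by
  refine ⟨fun h => ?_, simple_mem_parabolic⟩
  obtain ⟨ω, hJ, hr, h⟩ := exists_isReduced_of_mem_parabolic h
  have hl := hr.eq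
  rw [h, length_simple] at hl
  obtain ⟨j, rfl⟩ := List.length_eq_one_iff.1 hl.symm
  rw [wordProd_singleton] at h
  rw [← cs.simple_injective h]
  exact hJ j (by simp)

theorem IsRightInversion.mem_parabolic {J : Set B} {x t : W} (h : cs.IsRightInversion x t)
    (hx : x ∈ cs.parabolic J) : t ∈ cs.parabolic J := by
  revert t
  refine parabolic_induction_right (p := fun x => ∀ {t}, cs.IsRightInversion x t →
    t ∈ cs.parabolic J) hx (fun h => by simp [IsRightInversion] at h) ?_
  · intro x _ i hi ih t h
    have hs := simple_mem_parabolic (cs := cs) hi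
    by_cases h1 : cs.IsRightInversion (cs.simple i) t
    · rwa [(cs.isRightInversion_simple_iff i).1 h1]
    · have h2 := (h.1.isRightInversion_mul cs x (cs.simple i)).1 h
      have h3 := ih (t := cs.simple i * t * (cs.simple i)⁻¹) (by tauto)
      have h4 := mul_mem (mul_mem hs h3) hs
      simpa [mul_assoc] using h4

theorem IsRightDescent.mem_of_mem_parabolic {J : Set B} {x : W} {i : B}
    (h : cs.IsRightDescent x i) (hx : x ∈ cs.parabolic J) : i ∈ J :=
  simple_mem_parabolic_iff.1
    (((cs.isRightInversion_simple_iff_isRightDescent x i).2 h).mem_parabolic hx)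

theorem IsLeftDescent.mem_of_mem_parabolic {J : Set B} {x : W} {i : B}
    (h : cs.IsLeftDescent x i) (hx : x ∈ cs.parabolic J) : i ∈ J :=
  (cs.isRightDescent_inv_iff.2 h).mem_of_mem_parabolic (inv_mem hx)

theorem BruhatLE.mem_parabolic {J : Set B} {u v : W} (h : cs.BruhatLE u v)
    (hv : v ∈ cs.parabolic J) : u ∈ cs.parabolic J := by
  induction h with
  | refl => exact hv
  | @tail x y _ h ih =>
    have he : y * (x⁻¹ * y) = x := by
      rw [← h.1.inv]
      simp
    have h1 : cs.IsRightInversion y (x⁻¹ * y) := ⟨h.1, by rw [he, h.2]; exact Nat.lt_succ_self _⟩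
    apply ih
    have := mul_mem hv (h1.mem_parabolic hv)
    rwa [he] at this

theorem mem_parabolic_inter {J K : Set B} {x : W} (hJ : x ∈ cs.parabolic J)
    (hK : x ∈ cs.parabolic K) : x ∈ cs.parabolic (J ∩ K) := by
  induction hn : cs.length x using Nat.strong_induction_on generalizing x with
  | _ n ih =>
    by_cases h1 : x = 1
    · rw [h1]
      exact one_mem _
    obtain ⟨i, hi⟩ := cs.exists_rightDescent_of_ne_one h1
    have hiJ := hi.mem_of_mem_parabolic hJ
    have hiK := hi.mem_of_mem_parabolic hK
    have h2 := ih _ (hn ▸ hi) (mul_mem hJ (simple_mem_parabolic hiJ))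
      (mul_mem hK (simple_mem_parabolic hiK)) rfl
    have h3 := mul_mem h2 (simple_mem_parabolic (cs := cs) (J := J ∩ K) ⟨hiJ, hiK⟩)
    rwa [simple_mul_simple_cancel_right] at h3

theorem support_mono {u v : W} (h : cs.BruhatLE u v) : cs.support u ⊆ cs.support v :=
  fun _ hi => BruhatLE.trans hi h

theorem support_subset {J : Set B} {x : W} (hx : x ∈ cs.parabolic J) : cs.support x ⊆ J :=
  fun _ hi => simple_mem_parabolic_iff.1 (BruhatLE.mem_parabolic hi hx)

variable (cs) in
theorem mem_parabolic_support (x : W) : x ∈ cs.parabolic (cs.support x) := by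
  induction hn : cs.length x using Nat.strong_induction_on generalizing x with
  | _ n ih =>
    by_cases h1 : x = 1
    · rw [h1]
      exact one_mem _
    obtain ⟨i, hi⟩ := cs.exists_leftDescent_of_ne_one h1
    have h2 := parabolic_mono (support_mono hi.simple_mul_le) (ih _ (hn ▸ hi) _ rfl)
    have h3 := mul_mem (simple_mem_parabolic (cs := cs) (J := cs.support x) hi.simple_le) h2
    rwa [simple_mul_simple_cancel_left] at h3

theorem BruhatLE.mem_parabolic_support {u v : W} (h : cs.BruhatLE u v) :
    u ∈ cs.parabolic (cs.support v) :=
  h.mem_parabolic (cs.mem_parabolic_support v)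

/-! ### Minimal coset representatives -/

theorem length_mul_of_mem_minRightReps {J : Set B} {x y : W} (hx : x ∈ cs.minRightReps J)
    (hy : y ∈ cs.parabolic J) : cs.length (x * y) = cs.length x + cs.length y := by
  have key : ∀ x : W, (∀ z ∈ cs.parabolic J, cs.length x ≤ cs.length (x * z)) →
      ∀ n, ∀ y ∈ cs.parabolic J, cs.length y = n →
        cs.length (x * y) = cs.length x + cs.length y := by
    intro x hx n
    induction n with
    | zero =>
      intro y _ hn
      rw [length_eq_zero_iff] at hn
      simp [hn]
    | succ n ih =>
      intro y hy hn
      have hne : y ≠ 1 := by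
        rintro rfl
        simp at hn
      obtain ⟨i, hi⟩ := cs.exists_rightDescent_of_ne_one hne
      have hiJ := simple_mem_parabolic (cs := cs) (hi.mem_of_mem_parabolic hy)
      rw [isRightDescent_iff] at hi
      set z := y * cs.simple i with hz
      have hyz : y = z * cs.simple i := by simp [hz]
      have hzJ : z ∈ cs.parabolic J := mul_mem hy hiJ
      have h1 := ih z hzJ (by omega)
      have h2 : ¬ cs.IsRightDescent (x * z) i := by
        rw [← isRightInversion_simple_iff_isRightDescent,
          (cs.isReflection_simple i).isRightInversion_mul,
          isRightInversion_simple_iff_isRightDescent]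
        have h3 : ¬ cs.IsRightDescent z i := by
          rw [IsRightDescent, ← hyz]
          omega
        have h4 : ¬ cs.IsRightInversion x (z * cs.simple i * z⁻¹) := fun h =>
          (hx _ (mul_mem (mul_mem hzJ hiJ) (inv_mem hzJ))).not_gt h.2
        tauto
      rw [not_isRightDescent_iff, mul_assoc, ← hyz] at h2
      omega
  -- `x * z` is a shortest element of `x W_J`, to which `key` applies. If `z ≠ 1`, a right descent
  -- of `z⁻¹` would be a descent of `x` in `J`.
  obtain ⟨z, ⟨hz, hmin⟩⟩ : ∃ z ∈ cs.parabolic J,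
      ∀ z' ∈ cs.parabolic J, cs.length (x * z) ≤ cs.length (x * z') := by
    have := (measure fun z : W => cs.length (x * z)).wf.has_min
      (cs.parabolic J : Set W) ⟨1, one_mem _⟩
    obtain ⟨z, hz, h⟩ := this
    exact ⟨z, hz, fun z' hz' => not_lt.1 (h z' hz')⟩
  have hmin' : ∀ z' ∈ cs.parabolic J, cs.length (x * z) ≤ cs.length (x * z * z') := by
    intro z' hz'
    rw [mul_assoc]
    exact hmin _ (mul_mem hz hz')
  have hz1 : z = 1 := by
    by_contra hne
    obtain ⟨i, hi⟩ := cs.exists_rightDescent_of_ne_one (inv_ne_one.2 hne)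
    have hiJ := hi.mem_of_mem_parabolic (inv_mem hz)
    refine hx i hiJ ?_
    have h1 := key _ hmin' _ z⁻¹ (inv_mem hz) rfl
    have h2 := cs.length_mul_le (x * z) (z⁻¹ * cs.simple i)
    simp only [IsRightDescent] at hi ⊢
    have e1 : x * z * (z⁻¹ * cs.simple i) = x * cs.simple i := by simp [mul_assoc]
    rw [mul_inv_cancel_right] at h1
    rw [e1] at h2
    omega
  subst hz1
  rw [mul_one] at hmin'
  exact key x hmin' _ y hy rfl

theorem inv_mem_minRightReps {J : Set B} {x : W} :
    x⁻¹ ∈ cs.minRightReps J ↔ x ∈ cs.minLeftReps J := by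
  simp [minRightReps, minLeftReps, isRightDescent_inv_iff]

theorem length_mul_of_mem_minLeftReps {J : Set B} {x y : W} (hx : x ∈ cs.parabolic J)
    (hy : y ∈ cs.minLeftReps J) : cs.length (x * y) = cs.length x + cs.length y := by
  have := length_mul_of_mem_minRightReps (inv_mem_minRightReps.2 hy) (inv_mem hx)
  rwa [← mul_inv_rev, length_inv, length_inv, length_inv, add_comm] at this

variable (cs) in
theorem exists_left_factorization (J : Set B) (w : W) :
    ∃ x ∈ cs.parabolic J, ∃ y ∈ cs.minLeftReps J, w = x * y :=
  ⟨_, (cs.leftRep_spec J w).2, _, (cs.leftRep_spec J w).1, by simp⟩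

/-! ### The maximum of `[e, w] ∩ W_H` -/

/-- Induction along a left descent `i` of `w`: elements of `[e, w]` without left descent `i` already
lie below `s_i w`, so the maximum is the old one `m`, or the larger of `m` and `s_i m` when `i ∈ H`.
-/
theorem exists_max_parabolic (H : Set B) (w : W) :
    ∃ m, cs.BruhatLE m w ∧ m ∈ cs.parabolic H ∧
      ∀ u, cs.BruhatLE u w → u ∈ cs.parabolic H → cs.BruhatLE u m := by
  induction hn : cs.length w using Nat.strong_induction_on generalizing w with
  | _ n ih =>
    by_cases h1 : w = 1
    · refine ⟨1, cs.one_bruhatLE w, one_mem _, fun u hu _ => ?_⟩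
      rwa [h1] at hu
    obtain ⟨i, hi⟩ := cs.exists_leftDescent_of_ne_one h1
    obtain ⟨m, hmw, hmH, hm⟩ := ih _ (hn ▸ hi) (cs.simple i * w) rfl
    have hmw' := hmw.trans hi.simple_mul_le
    have hasc : ∀ u, cs.BruhatLE u w → u ∈ cs.parabolic H → ¬ cs.IsLeftDescent u i →
        cs.BruhatLE u m := fun u hu huH hd =>
      hm u (hu.le_simple_mul_of_le (BruhatLE.refl u) (bruhatLE_simple_mul hd)) huH
    by_cases hiH : i ∈ H
    · have hs := simple_mem_parabolic (cs := cs) hiH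
      have key : ∀ m', cs.BruhatLE m m' → cs.BruhatLE (cs.simple i * m) m' →
          ∀ u, cs.BruhatLE u w → u ∈ cs.parabolic H → cs.BruhatLE u m' := by
        intro m' h h' u hu huH
        by_cases hd : cs.IsLeftDescent u i
        · have h2 := hasc (cs.simple i * u) (hd.simple_mul_le.trans hu) (mul_mem hs huH)
            (cs.isLeftDescent_iff_not_isLeftDescent_mul.1 hd)
          simpa using h2.simple_mul_le_of_le h h'
        · exact (hasc u hu huH hd).trans h
      by_cases hd : cs.IsLeftDescent m i
      · exact ⟨m, hmw', hmH, key m (BruhatLE.refl m) hd.simple_mul_le⟩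
      · exact ⟨cs.simple i * m, hmw'.simple_mul_le hi, mul_mem hs hmH,
          key _ (bruhatLE_simple_mul hd) (BruhatLE.refl _)⟩
    · exact ⟨m, hmw', hmH, fun u hu huH =>
        hasc u hu huH fun hd => hiH (hd.mem_of_mem_parabolic huH)⟩

variable (cs) in
theorem longest_mem_parabolic (H : Set B) (w : W) : cs.longest H w ∈ cs.parabolic H :=
  (cs.exists_longest H w).choose_spec.1.2

/-- `longest` is chosen by length only; being below the maximum and at least as long, it equals the
maximum. -/
theorem BruhatLE.le_longest {H : Set B} {u w : W} (hu : cs.BruhatLE u w)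
    (huH : u ∈ cs.parabolic H) : cs.BruhatLE u (cs.longest H w) := by
  obtain ⟨m, hmw, hmH, hm⟩ := exists_max_parabolic (cs := cs) H w
  have h := (cs.exists_longest H w).choose_spec
  have : cs.longest H w = m := (hm _ h.1.1 h.1.2).eq_of_length_le (h.2 m hmw hmH)
  rw [this]
  exact hm u hu huH

/-! ### Maps of dihedral intervals that commute with multiplications -/

theorem map_mul_of_mem_parabolic {D : Set B} {I : Set W} {M : W → W}
    (hR : ∀ i ∈ D, ∀ x ∈ I, x * cs.simple i ∈ I ∧ M (x * cs.simple i) = M x * cs.simple i)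
    {x y : W} (hx : x ∈ I) (hy : y ∈ cs.parabolic D) : x * y ∈ I ∧ M (x * y) = M x * y := by
  refine parabolic_induction_right (p := fun y => x * y ∈ I ∧ M (x * y) = M x * y) hy
    (by simpa using hx) ?_
  rintro y - i hi ⟨h1, h2⟩
  have h3 := hR i hi _ h1
  rw [h2, mul_assoc, mul_assoc] at h3
  exact h3

theorem map_parabolic_mul_of_mem {D : Set B} {I : Set W} {M : W → W}
    (hL : ∀ i ∈ D, ∀ x ∈ I, cs.simple i * x ∈ I ∧ M (cs.simple i * x) = cs.simple i * M x)
    {x y : W} (hx : x ∈ I) (hy : y ∈ cs.parabolic D) : y * x ∈ I ∧ M (y * x) = y * M x := by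
  refine parabolic_induction_left (p := fun y => y * x ∈ I ∧ M (y * x) = y * M x) hy
    (by simpa using hx) ?_
  rintro y - i hi ⟨h1, h2⟩
  have h3 := hL i hi _ h1
  rw [h2, ← mul_assoc, ← mul_assoc] at h3
  exact h3

theorem exists_mul_of_mem_parabolic_of_commute {E : Set B} {s : B}
    (hE : E ⊆ cs.commutingSet (cs.simple s)) {g : W} (hg : g ∈ cs.parabolic E) :
    ∃ y ∈ cs.parabolic (E ∩ {s}), ∃ g' ∈ cs.parabolic (E \ {s}), g = y * g' := by
  refine parabolic_induction_left (p := fun g => ∃ y ∈ cs.parabolic (E ∩ {s}),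
    ∃ g' ∈ cs.parabolic (E \ {s}), g = y * g') hg ⟨1, one_mem _, 1, one_mem _, by simp⟩ ?_
  rintro _ - i hi ⟨y, hy, g', hg', rfl⟩
  by_cases his : i = s
  · exact ⟨cs.simple i * y, mul_mem (simple_mem_parabolic ⟨hi, his⟩) hy, g', hg', by
      rw [mul_assoc]⟩
  · refine ⟨y, hy, cs.simple i * g', mul_mem (simple_mem_parabolic ⟨hi, his⟩) hg', ?_⟩
    have hc : cs.simple i * y = y * cs.simple i :=
      parabolic_induction_left (p := fun y => cs.simple i * y = y * cs.simple i) hy (by simp)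
        (by
          rintro z - j ⟨-, rfl⟩ hz
          have h1 : cs.simple i * cs.simple j = cs.simple j * cs.simple i := hE hi
          rw [← mul_assoc, h1, mul_assoc, hz, mul_assoc])
    rw [← mul_assoc, hc, mul_assoc]

theorem mem_parabolic_singleton {t : B} {x : W} (hx : x ∈ cs.parabolic {t}) :
    x = 1 ∨ x = cs.simple t := by
  refine parabolic_induction_left (p := fun x => x = 1 ∨ x = cs.simple t) hx (Or.inl rfl) ?_
  rintro _ - i rfl (rfl | rfl) <;> simp

theorem commute_of_mem_parabolic {D : Set B} {g x : W}
    (h : ∀ i ∈ D, cs.simple i * g = g * cs.simple i) (hx : x ∈ cs.parabolic D) :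
    x * g = g * x := by
  refine parabolic_induction_left (p := fun x => x * g = g * x) hx (by simp) ?_
  intro y _ i hi hy
  rw [mul_assoc, hy, ← mul_assoc, h i hi, mul_assoc]

/-- Letters of `D` are never left descents of `u`, so lifting strips them from `g` one by one. -/
theorem BruhatLE.of_le_mul_of_disjoint {D H : Set B} (hDH : Disjoint D H) {g u x : W}
    (hg : g ∈ cs.parabolic D) (hu : u ∈ cs.parabolic H) (h : cs.BruhatLE u (g * x)) :
    cs.BruhatLE u x := by
  revert h
  refine parabolic_induction_left (p := fun g => cs.BruhatLE u (g * x) → cs.BruhatLE u x) hg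
    (by simp) ?_
  intro y _ i hi ih h
  refine ih ?_
  have hd : ¬ cs.IsLeftDescent u i := fun hd =>
    Set.disjoint_left.1 hDH hi (hd.mem_of_mem_parabolic hu)
  have := h.le_simple_mul_of_le (i := i) (BruhatLE.refl u) (bruhatLE_simple_mul hd)
  rwa [← mul_assoc, simple_mul_simple_cancel_left] at this

theorem bruhatLE_of_mul_eq_mul {C D H : Set B} (hDH : Disjoint D H) {g h b₁ b₂ : W}
    (hg : g ∈ cs.parabolic D) (hh : h ∈ cs.parabolic C) (hb₂ : b₂ ∈ cs.parabolic H)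
    (hb₂C : b₂ ∈ cs.minRightReps C) (heq : g * b₁ = b₂ * h) : cs.BruhatLE b₂ b₁ := by
  refine BruhatLE.of_le_mul_of_disjoint hDH hg hb₂ ?_
  rw [heq]
  exact bruhatLE_mul_right (length_mul_of_mem_minRightReps hb₂C hh)

theorem eq_of_mul_eq_mul {C D H : Set B} (hDH : Disjoint D H) {g h b₁ b₂ : W}
    (hg : g ∈ cs.parabolic D) (hh : h ∈ cs.parabolic C) (hb₁ : b₁ ∈ cs.parabolic H)
    (hb₂ : b₂ ∈ cs.parabolic H) (hb₁C : b₁ ∈ cs.minRightReps C)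
    (hb₂C : b₂ ∈ cs.minRightReps C) (heq : g * b₁ = b₂ * h) : b₁ = b₂ := by
  refine BruhatLE.antisymm (bruhatLE_of_mul_eq_mul hDH (inv_mem hg) (inv_mem hh) hb₁ hb₁C ?_)
    (bruhatLE_of_mul_eq_mul hDH hg hh hb₂ hb₂C heq)
  rw [inv_mul_eq_iff_eq_mul, ← mul_assoc, heq, mul_inv_cancel_right]

/-- Since `b * h` is length-additive, `t` is a left descent of `g * b` but not of `g`. By the
cocycle `g⁻¹ t g` is then an inversion of `b⁻¹`, hence lies in `W_H ∩ W_{D ∪ {t}} = W_{t}` and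
equals `t`. -/
theorem commute_of_isLeftDescent {C D H : Set B} (hDH : Disjoint D H) {t : B} (htH : t ∈ H)
    {g h b : W} (hg : g ∈ cs.parabolic D) (hh : h ∈ cs.parabolic C) (hb : b ∈ cs.parabolic H)
    (hbC : b ∈ cs.minRightReps C) (heq : g * b = b * h) (ht : cs.IsLeftDescent b t) :
    cs.simple t * g = g * cs.simple t := by
  have hd : cs.IsLeftDescent (g * b) t := by
    have h1 := length_mul_of_mem_minRightReps hbC hh
    have h2 := cs.length_mul_le (cs.simple t * b) h
    rw [IsLeftDescent] at ht ⊢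
    rw [heq, ← mul_assoc]
    omega
  have hr := cs.isReflection_simple t
  rw [← isRightDescent_inv_iff, mul_inv_rev, ← isRightInversion_simple_iff_isRightDescent,
    hr.isRightInversion_mul] at hd
  have h1 : ¬ cs.IsRightInversion g⁻¹ (cs.simple t) := by
    rw [isRightInversion_simple_iff_isRightDescent]
    exact fun h => Set.disjoint_left.1 hDH (h.mem_of_mem_parabolic (inv_mem hg)) htH
  have h2 : cs.IsRightInversion b⁻¹ (g⁻¹ * cs.simple t * g⁻¹⁻¹) := by tauto
  rw [inv_inv] at h2
  have h3 := h2.mem_parabolic (inv_mem hb)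
  have hg' := parabolic_mono (cs := cs) (Set.subset_insert t D) hg
  have h4 : g⁻¹ * cs.simple t * g ∈ cs.parabolic (insert t D) :=
    mul_mem (mul_mem (inv_mem hg') (simple_mem_parabolic (Set.mem_insert t D))) hg'
  have h5 := parabolic_mono (cs := cs) (K := {t}) (by
    rintro i ⟨rfl | hi, hi'⟩
    · rfl
    · exact absurd hi' (Set.disjoint_left.1 hDH hi)) (mem_parabolic_inter h4 h3)
  rcases mem_parabolic_singleton h5 with h6 | h6
  · have h7 := h2.2
    rw [h6, mul_one] at h7
    exact absurd h7 (lt_irrefl _)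
  · rwa [mul_assoc, inv_mul_eq_iff_eq_mul] at h6

/-- As `g` commutes with `s`, a left descent `s` of `b` can be removed; the next left descent must
be `t`, and `commute_of_isLeftDescent` applies. -/
theorem eq_one_or_eq_simple_or_commute {C D : Set B} {s t : B} (hDH : Disjoint D {s, t})
    (hDs : D ⊆ cs.commutingSet (cs.simple s)) {g h b : W}
    (hg : g ∈ cs.parabolic D) (hh : h ∈ cs.parabolic C) (hb : b ∈ cs.parabolic {s, t})
    (hbC : b ∈ cs.minRightReps C) (heq : g * b = b * h) :
    b = 1 ∨ b = cs.simple s ∨ cs.simple t * g = g * cs.simple t := by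
  by_cases hb1 : b = 1
  · exact Or.inl hb1
  right
  have hst : t ∈ ({s, t} : Set B) := by simp
  have hss : s ∈ ({s, t} : Set B) := by simp
  obtain ⟨i, hi⟩ := cs.exists_leftDescent_of_ne_one hb1
  rcases hi.mem_of_mem_parabolic hb with his | rfl
  · subst his
    by_cases hb' : cs.simple i * b = 1
    · left
      rw [mul_eq_one_iff_eq_inv'] at hb'
      rw [hb', inv_simple]
    right
    have hb'H := mul_mem (simple_mem_parabolic (cs := cs) hss) hb
    have hb'C : cs.simple i * b ∈ cs.minRightReps C := by
      intro j hj hd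
      refine hbC j hj ?_
      have h1 := cs.isLeftDescent_iff.1 hi
      have h2 := cs.length_simple_mul (cs.simple i * (b * cs.simple j)) i
      rw [simple_mul_simple_cancel_left] at h2
      rw [IsRightDescent, mul_assoc] at hd
      rw [IsRightDescent]
      omega
    have hgi : g * cs.simple i = cs.simple i * g :=
      (commute_of_mem_parabolic (fun j hj => hDs hj) hg)
    have heq' : g * (cs.simple i * b) = cs.simple i * b * h := by
      rw [← mul_assoc, hgi, mul_assoc, heq, mul_assoc]
    obtain ⟨j, hj⟩ := cs.exists_leftDescent_of_ne_one hb'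
    rcases hj.mem_of_mem_parabolic hb'H with rfl | rfl
    · exact absurd hj (cs.isLeftDescent_iff_not_isLeftDescent_mul.1 hi)
    · exact commute_of_isLeftDescent hDH hst hg hh hb'H hb'C heq' hj
  · exact Or.inr (commute_of_isLeftDescent hDH hst hg hh hb hbC heq hi)

/-! ### Transport of `g * b₁ = b₂ * h` through `M` -/

section middle

variable {s t : B} {I : Set W} {M : W → W} {A C : Set B}

theorem mul_map_eq_map_mul_of_subset
    (hI : ∀ x ∈ I, x ∈ cs.parabolic {s, t}) (hMI : ∀ x ∈ I, M x ∈ cs.parabolic {s, t})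
    (hM1 : M 1 = cs.simple s) (hMs : M (cs.simple s) = 1)
    (hL : ∀ i ∈ A ∩ {s, t}, ∀ x ∈ I,
      cs.simple i * x ∈ I ∧ M (cs.simple i * x) = cs.simple i * M x)
    (hR : ∀ i ∈ C ∩ {s, t}, ∀ x ∈ I,
      x * cs.simple i ∈ I ∧ M (x * cs.simple i) = M x * cs.simple i)
    (hAC : A ∩ (C ∪ {s, t}) ⊆ cs.commutingSet (cs.simple s)) (htA : t ∈ A → t = s)
    {g h b₁ b₂ : W} (hg : g ∈ cs.parabolic A) (hh : h ∈ cs.parabolic C) (hb₁ : b₁ ∈ I)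
    (hb₂ : b₂ ∈ I) (heq : g * b₁ = b₂ * h) : g * M b₁ = M b₂ * h := by
  have hgCH : g ∈ cs.parabolic (C ∪ {s, t}) := by
    have hsub : cs.parabolic {s, t} ≤ cs.parabolic (C ∪ {s, t}) :=
      parabolic_mono Set.subset_union_right
    rw [← mul_inv_cancel_right g b₁, heq]
    exact mul_mem (mul_mem (hsub (hI _ hb₂)) (parabolic_mono Set.subset_union_left hh))
      (inv_mem (hsub (hI _ hb₁)))
  set E := A ∩ (C ∪ {s, t}) with hE
  obtain ⟨y, hy, g', hg', rfl⟩ :=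
    exists_mul_of_mem_parabolic_of_commute hAC (mem_parabolic_inter hg hgCH)
  obtain ⟨hyI, hyM⟩ := map_parabolic_mul_of_mem hL hb₂ (inv_mem (parabolic_mono (cs := cs) (by
    rintro i ⟨⟨hi, -⟩, rfl⟩
    exact ⟨hi, by simp⟩ : E ∩ {s} ⊆ A ∩ {s, t}) hy))
  -- The right factors in `W_{C ∩ H}` move into `h'`; `M` commutes with them, so the claim is
  -- unchanged.
  obtain ⟨x₁, hx₁, y₁, hy₁, h₁⟩ := cs.exists_right_factorization (C ∩ {s, t}) b₁
  obtain ⟨x₂, hx₂, y₂, hy₂, h₂⟩ := cs.exists_right_factorization (C ∩ {s, t}) (y⁻¹ * b₂)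
  have hx₁' : x₁ = b₁ * y₁⁻¹ := by rw [h₁, mul_inv_cancel_right]
  have hx₂' : x₂ = y⁻¹ * b₂ * y₂⁻¹ := by rw [h₂, mul_inv_cancel_right]
  obtain ⟨hx₁I, hx₁M⟩ := map_mul_of_mem_parabolic hR hb₁ (inv_mem hy₁)
  obtain ⟨hx₂I, hx₂M⟩ := map_mul_of_mem_parabolic hR hyI (inv_mem hy₂)
  rw [← hx₁'] at hx₁I hx₁M
  rw [← hx₂'] at hx₂I hx₂M
  have hmin : ∀ x ∈ I, x ∈ cs.minRightReps (C ∩ {s, t}) → x ∈ cs.minRightReps C :=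
    fun x hxI hx i hi hd => hx i ⟨hi, hd.mem_of_mem_parabolic (hI x hxI)⟩ hd
  have hsub : cs.parabolic (C ∩ {s, t}) ≤ cs.parabolic C := parabolic_mono Set.inter_subset_left
  set h' := y₂ * h * y₁⁻¹ with hh'def
  have hh' : h' ∈ cs.parabolic C :=
    mul_mem (mul_mem (hsub hy₂) hh) (inv_mem (hsub hy₁))
  have heq' : g' * x₁ = x₂ * h' := by
    have h3 : g' * b₁ = y⁻¹ * b₂ * h := by
      rw [mul_assoc, eq_inv_mul_iff_mul_eq, ← mul_assoc, heq]
    rw [hx₁', hx₂', hh'def, ← mul_assoc, h3]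
    simp [mul_assoc]
  suffices hgoal : g' * M x₁ = M x₂ * h' by
    rw [hx₁M, hx₂M, hyM, hh'def] at hgoal
    have h4 : y * (g' * (M b₁ * y₁⁻¹)) * y₁ =
        y * (y⁻¹ * M b₂ * y₂⁻¹ * (y₂ * h * y₁⁻¹)) * y₁ := by rw [hgoal]
    simpa [mul_assoc] using h4
  have hDH : Disjoint (E \ {s}) {s, t} := by
    rw [Set.disjoint_left]
    rintro i ⟨hiE, his⟩ (rfl | rfl)
    · exact his rfl
    · exact his (htA hiE.1)
  have hDs : E \ {s} ⊆ cs.commutingSet (cs.simple s) := fun i hi => hAC hi.1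
  have hgs : g' * cs.simple s = cs.simple s * g' :=
    commute_of_mem_parabolic (fun i hi => hDs hi) hg'
  have hx : x₁ = x₂ := eq_of_mul_eq_mul hDH hg' hh' (hI _ hx₁I) (hI _ hx₂I)
    (hmin _ hx₁I hx₁) (hmin _ hx₂I hx₂) heq'
  rw [← hx] at heq' ⊢
  rcases eq_one_or_eq_simple_or_commute hDH hDs hg' hh' (hI _ hx₁I) (hmin _ hx₁I hx₁) heq' with
    h5 | h5 | h5
  · rw [h5, mul_one, one_mul] at heq'
    rw [h5, hM1, ← heq', hgs]
  · rw [h5, hgs] at heq'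
    rw [h5, hMs, mul_one, one_mul]
    exact mul_left_cancel heq'
  · have hc : ∀ x ∈ cs.parabolic {s, t}, x * g' = g' * x := fun x hx =>
      commute_of_mem_parabolic (D := {s, t}) (by
        rintro i (rfl | rfl)
        · exact hgs.symm
        · exact h5) hx
    rw [← hc _ (hI _ hx₁I)] at heq'
    rw [← mul_left_cancel heq', hc _ (hMI _ hx₁I)]

/-- If `g * b₁ = b₂ * h`, where `g` and `h` lie in parabolic subgroups whose letters in `{s, t}`
commute with `M` on the left and on the right respectively, then `g * M b₁ = M b₂ * h`. -/
theorem mul_map_eq_map_mul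
    (hI : ∀ x ∈ I, x ∈ cs.parabolic {s, t}) (hMI : ∀ x ∈ I, M x ∈ cs.parabolic {s, t})
    (hM1 : M 1 = cs.simple s) (hMs : M (cs.simple s) = 1)
    (hL : ∀ i ∈ A ∩ {s, t}, ∀ x ∈ I,
      cs.simple i * x ∈ I ∧ M (cs.simple i * x) = cs.simple i * M x)
    (hR : ∀ i ∈ C ∩ {s, t}, ∀ x ∈ I,
      x * cs.simple i ∈ I ∧ M (x * cs.simple i) = M x * cs.simple i)
    {J K : Set B} (hA : A ⊆ K) (hC : C ⊆ J) (hJK : cs.IsComplementary (cs.simple s) J K)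
    {g h b₁ b₂ : W} (hg : g ∈ cs.parabolic A) (hh : h ∈ cs.parabolic C) (hb₁ : b₁ ∈ I)
    (hb₂ : b₂ ∈ I) (heq : g * b₁ = b₂ * h) : g * M b₁ = M b₂ * h := by
  have hsJK : s ∈ J ∩ K := by
    rw [hJK.2]
    exact rfl
  by_cases h₁ : t ∈ J ∧ (t ∈ A → t = s)
  · refine mul_map_eq_map_mul_of_subset hI hMI hM1 hMs hL hR ?_ h₁.2 hg hh hb₁ hb₂ heq
    rw [← hJK.2]
    rintro i ⟨hi, hi' | rfl | rfl⟩
    · exact ⟨hC hi', hA hi⟩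
    · exact hsJK
    · exact ⟨h₁.1, hA hi⟩
  by_cases h₂ : t ∈ K ∧ (t ∈ C → t = s)
  · have key := mul_map_eq_map_mul_of_subset (cs := cs) (s := s) (t := t) (I := {x | x⁻¹ ∈ I})
      (M := fun x => (M x⁻¹)⁻¹) (A := C) (C := A) (g := h) (h := g) (b₁ := b₁⁻¹) (b₂ := b₂⁻¹)
      (fun x hx => by simpa using inv_mem (hI _ hx)) (fun x hx => inv_mem (hMI _ hx))
      (by simp [hM1]) (by simp [hMs])
      (fun i hi x hx => by
        obtain ⟨h3, h4⟩ := hR i hi _ hx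
        exact ⟨by simpa using h3, by simp [h4]⟩)
      (fun i hi x hx => by
        obtain ⟨h3, h4⟩ := hL i hi _ hx
        exact ⟨by simpa using h3, by simp [h4]⟩)
      (by
        rw [← hJK.2]
        rintro i ⟨hi, hi' | rfl | rfl⟩
        · exact ⟨hC hi, hA hi'⟩
        · exact hsJK
        · exact ⟨hC hi, h₂.1⟩) h₂.2 hh hg (by simpa using hb₁) (by simpa using hb₂)
      (by rw [mul_inv_eq_iff_eq_mul, mul_assoc, heq, inv_mul_cancel_left])
    simp only [inv_inv] at key
    rw [mul_inv_eq_iff_eq_mul, mul_assoc, eq_inv_mul_iff_mul_eq] at key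
    exact key.symm
  -- If `t` were missing from `J` or `K`, it would be missing from `C` or `A`, and an earlier case
  -- would apply. So `t ∈ J ∩ K` commutes with `s`.
  have hJK' : t ∈ J ∪ K := by
    rw [hJK.1]
    trivial
  obtain ⟨htJ, htK, htA⟩ : t ∈ J ∧ t ∈ K ∧ t ∈ A := by
    have h3 := @hA t
    have h4 := @hC t
    rcases hJK' with h | h <;> tauto
  have hts : cs.simple t * cs.simple s = cs.simple s * cs.simple t := by
    have : t ∈ J ∩ K := ⟨htJ, htK⟩
    rwa [hJK.2] at this
  -- Each `b` is `1` or `t` times `1` or `s`; as `M` commutes with left multiplication by `t`, it is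
  -- determined by its values at `1` and `s`.
  have hM : ∀ b ∈ I, M b = cs.simple s * b := by
    intro b hb
    obtain ⟨y, hy, x, hx, hyx⟩ := exists_mul_of_mem_parabolic_of_commute (s := t) (by
      rintro i (rfl | rfl)
      · exact hts.symm
      · exact rfl) (hI b hb)
    have hy' := parabolic_mono (cs := cs) (K := {t}) Set.inter_subset_right hy
    have hx' := parabolic_mono (cs := cs) (K := {s}) (by
      rintro i ⟨rfl | rfl, hi⟩
      · rfl
      · exact absurd rfl hi) hx
    have hL' : ∀ i ∈ ({t} : Set B), ∀ x ∈ I,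
        cs.simple i * x ∈ I ∧ M (cs.simple i * x) = cs.simple i * M x := by
      rintro i rfl
      exact hL i ⟨htA, by simp⟩
    have hxI : x ∈ I := by
      have := (map_parabolic_mul_of_mem hL' hb (inv_mem hy')).1
      rwa [hyx, inv_mul_cancel_left] at this
    have hys : y * cs.simple s = cs.simple s * y :=
      commute_of_mem_parabolic (D := {t}) (by rintro i rfl; exact hts) hy'
    rw [hyx, (map_parabolic_mul_of_mem hL' hxI hy').2, ← mul_assoc, ← hys, mul_assoc]
    congr 1
    rcases mem_parabolic_singleton hx' with rfl | rfl
    · rw [hM1, mul_one]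
    · rw [hMs, simple_mul_simple_self]
  have hsub : cs.parabolic {s, t} ≤ cs.parabolic J := by
    refine parabolic_mono ?_
    rintro i (rfl | rfl)
    · exact hsJK.1
    · exact htJ
  have hgJ : g ∈ cs.parabolic J := by
    rw [← mul_inv_cancel_right g b₁, heq]
    exact mul_mem (mul_mem (hsub (hI _ hb₂)) (parabolic_mono hC hh)) (inv_mem (hsub (hI _ hb₁)))
  have hgs : g * cs.simple s = cs.simple s * g := by
    have h3 := mem_parabolic_inter hgJ (parabolic_mono hA hg)
    rw [hJK.2] at h3
    exact commute_of_mem_parabolic (fun i hi => hi) h3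
  rw [hM _ hb₁, hM _ hb₂, ← mul_assoc, hgs, mul_assoc, heq, mul_assoc]

end middle

/-! ### Factorizations of the elements of a lower interval -/

theorem IsRightInversion.bruhatLE_mul {x t : W} (h : cs.IsRightInversion x t)
    (hl : cs.length x ≤ cs.length (x * t) + 1) : cs.BruhatLE (x * t) x := by
  refine BruhatCovers.le ⟨?_, le_antisymm hl h.2⟩
  simpa [h.1.inv] using h.1

/-- Descending a cover multiplies `x' * y'` by an inversion, which by the cocycle comes from `y'`
or, after conjugation, from `x'`; only that factor shrinks. -/
theorem BruhatLE.exists_mul {u x y : W} (h : cs.BruhatLE u (x * y))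
    (hl : cs.length (x * y) = cs.length x + cs.length y) :
    ∃ x' y', cs.BruhatLE x' x ∧ cs.BruhatLE y' y ∧ u = x' * y' ∧
      cs.length u = cs.length x' + cs.length y' := by
  induction h using Relation.ReflTransGen.head_induction_on with
  | refl => exact ⟨x, y, BruhatLE.refl x, BruhatLE.refl y, rfl, hl⟩
  | @head u v huv _ ih =>
    obtain ⟨x', y', hx, hy, rfl, hl'⟩ := ih
    obtain ⟨ht, hlv⟩ := huv
    set t := u⁻¹ * (x' * y') with htdef
    have hu : u = x' * y' * t := by
      rw [← ht.inv, htdef]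
      simp [mul_assoc]
    have hinv : cs.IsRightInversion (x' * y') t := ⟨ht, by rw [← hu]; omega⟩
    by_cases h1 : cs.IsRightInversion y' t
    · have h2 := cs.length_mul_le x' (y' * t)
      rw [← mul_assoc, ← hu] at h2
      have h3 := h1.2
      exact ⟨x', y' * t, hx, (h1.bruhatLE_mul (by omega)).trans hy, by rw [hu, mul_assoc],
        by omega⟩
    · rw [ht.isRightInversion_mul] at hinv
      have h1' : cs.IsRightInversion x' (y' * t * y'⁻¹) := by tauto
      have he : x' * (y' * t * y'⁻¹) * y' = u := by
        rw [hu]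
        simp [mul_assoc]
      have h2 := cs.length_mul_le (x' * (y' * t * y'⁻¹)) y'
      rw [he] at h2
      have h3 := h1'.2
      exact ⟨_, y', (h1'.bruhatLE_mul (by omega)).trans hx, hy, he.symm, by omega⟩

theorem BruhatLE.exists_isLengthAdditive {u w a b c : W} (h : cs.BruhatLE u w)
    (hw : cs.IsLengthAdditive w a b c) :
    ∃ a' b' c', cs.BruhatLE a' a ∧ cs.BruhatLE b' b ∧ cs.BruhatLE c' c ∧
      cs.IsLengthAdditive u a' b' c' := by
  obtain ⟨rfl, hl⟩ := hw
  have h1 := cs.length_mul_le (a * b) c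
  have h2 := cs.length_mul_le a b
  obtain ⟨x, c', hx, hc, rfl, hl'⟩ := h.exists_mul (by omega)
  obtain ⟨a', b', ha, hb, rfl, hl''⟩ := hx.exists_mul (by omega)
  exact ⟨a', b', c', ha, hb, hc, rfl, by omega⟩

theorem IsLengthAdditive.middle_le {u a b c : W} (h : cs.IsLengthAdditive u a b c) :
    cs.BruhatLE b u := by
  obtain ⟨rfl, hl⟩ := h
  have h1 := cs.length_mul_le (a * b) c
  have h2 := cs.length_mul_le a b
  exact (bruhatLE_mul_left (by omega)).trans (bruhatLE_mul_right (by omega))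

/-! ### Independence of the factorization -/

namespace MatchingSystem

variable {w : W} (𝒮 : cs.MatchingSystem w)

theorem exists_simple : ∃ s ∈ 𝒮.H, 𝒮.M 1 = cs.simple s ∧ 𝒮.M (cs.simple s) = 1 := by
  obtain ⟨h1, h2, h3⟩ := 𝒮.isMatching 1 (cs.one_bruhatLE _)
  have hl : cs.length (𝒮.M 1) = 1 := by
    rcases h3 with h | h
    · simpa using h.2
    · have := h.2
      rw [length_one] at this
      omega
  obtain ⟨s, hs⟩ := cs.length_eq_one_iff.1 hl
  refine ⟨s, ?_, hs, by rw [← hs, h2]⟩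
  rw [← simple_mem_parabolic_iff (cs := cs), ← hs]
  exact h1.mem_parabolic (cs.longest_mem_parabolic _ _)

theorem exists_eq_pair {s : B} (hs : s ∈ 𝒮.H) : ∃ t, 𝒮.H = {s, t} := by
  rcases 𝒮.card_H with h | h
  · obtain ⟨x, hx⟩ := Set.encard_eq_one.1 h
    rw [hx] at hs ⊢
    exact ⟨s, by simpa using hs.symm⟩
  · obtain ⟨x, y, -, hx⟩ := Set.encard_eq_two.1 h
    rw [hx] at hs ⊢
    rcases hs with rfl | rfl
    · exact ⟨y, rfl⟩
    · exact ⟨x, Set.pair_comm _ _⟩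

variable {𝒮}

/-- Two factorizations `a * b * c` of the same element, whose outer factors lie in parabolic
subgroups of `W_K` and `W_J` that are compatible with `M`, give the same value `a * M b * c`. -/
theorem mul_map_mul_eq {A C : Set B} (hA : A ⊆ 𝒮.K) (hC : C ⊆ 𝒮.J)
    (hL : ∀ i ∈ A ∩ 𝒮.H, cs.CommutesWithLeft (cs.longest 𝒮.H w) 𝒮.M i)
    (hR : ∀ i ∈ C ∩ 𝒮.H, cs.CommutesWithRight (cs.longest 𝒮.H w) 𝒮.M i)
    {a₁ b₁ c₁ a₂ b₂ c₂ : W} (ha₁ : a₁ ∈ cs.parabolic A) (ha₂ : a₂ ∈ cs.parabolic A)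
    (hb₁ : cs.BruhatLE b₁ (cs.longest 𝒮.H w)) (hb₂ : cs.BruhatLE b₂ (cs.longest 𝒮.H w))
    (hc₁ : c₁ ∈ cs.parabolic C) (hc₂ : c₂ ∈ cs.parabolic C)
    (h : a₁ * b₁ * c₁ = a₂ * b₂ * c₂) : a₁ * 𝒮.M b₁ * c₁ = a₂ * 𝒮.M b₂ * c₂ := by
  obtain ⟨s, hsH, hM1, hMs⟩ := 𝒮.exists_simple
  obtain ⟨t, hH⟩ := 𝒮.exists_eq_pair hsH
  have hI : ∀ x, cs.BruhatLE x (cs.longest 𝒮.H w) → x ∈ cs.parabolic {s, t} := by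
    intro x hx
    rw [← hH]
    exact hx.mem_parabolic (cs.longest_mem_parabolic _ _)
  have hJK : cs.IsComplementary (cs.simple s) 𝒮.J 𝒮.K := by
    rw [← hM1]
    exact (cs.isComplementary_iff 𝒮.commutingSet_subset).2 rfl
  have key := mul_map_eq_map_mul (I := {x | cs.BruhatLE x (cs.longest 𝒮.H w)}) (M := 𝒮.M)
    (A := A) (C := C) (g := a₂⁻¹ * a₁) (h := c₂ * c₁⁻¹) (b₁ := b₁) (b₂ := b₂) hI
    (fun x hx => hI _ (𝒮.isMatching x hx).1) hM1 hMs
    (fun i hi x hx => by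
      rw [← hH] at hi
      exact ⟨hx.simple_mul_le (hL i hi).1, (hL i hi).2 x hx⟩)
    (fun i hi x hx => by
      rw [← hH] at hi
      exact ⟨hx.mul_simple_le (hR i hi).1, (hR i hi).2 x hx⟩)
    hA hC hJK (mul_mem (inv_mem ha₂) ha₁) (mul_mem hc₂ (inv_mem hc₁)) hb₁ hb₂
    (by
      rw [← mul_assoc, eq_mul_inv_iff_mul_eq, mul_assoc, mul_assoc, inv_mul_eq_iff_eq_mul,
        ← mul_assoc, h, mul_assoc])
  rw [← mul_assoc, eq_mul_inv_iff_mul_eq, mul_assoc, mul_assoc, inv_mul_eq_iff_eq_mul,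
    ← mul_assoc, ← mul_assoc] at key
  exact key

theorem IsFactorization.support_left_subset {u a b c : W} (h : 𝒮.IsFactorization u a b c) :
    cs.support a ⊆ 𝒮.K := support_subset h.left_mem.1

theorem IsFactorization.support_right_subset {u a b c : W} (h : 𝒮.IsFactorization u a b c) :
    cs.support c ⊆ 𝒮.J := support_subset h.right_mem.1

theorem IsFactorization.middle_le_longest {u a b c : W} (h : 𝒮.IsFactorization u a b c)
    (hu : cs.BruhatLE u w) : cs.BruhatLE b (cs.longest 𝒮.H w) :=
  (h.lengthAdditive.middle_le.trans hu).le_longest h.middle_mem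

/-- A length-additive factorization below `a`, `b`, `c` is corrected by moving the `W_H`-parts of
the outer factors into the middle; supports only shrink, so the commutation conditions persist. -/
theorem IsFactorization.exists_of_le {u a b c : W} (hw : 𝒮.IsFactorization w a b c)
    (hu : cs.BruhatLE u w) : ∃ a' b' c', 𝒮.IsFactorization u a' b' c' := by
  obtain ⟨a', b', c', ha, hb, hc, rfl, hl⟩ := hu.exists_isLengthAdditive hw.lengthAdditive
  obtain ⟨x, hx, y, hy, rfl⟩ := cs.exists_right_factorization 𝒮.H a'
  obtain ⟨y', hy', z, hz, rfl⟩ := cs.exists_left_factorization 𝒮.H c'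
  have h1 := length_mul_of_mem_minRightReps hx hy
  have h2 := length_mul_of_mem_minLeftReps hy' hz
  have hxa := (bruhatLE_mul_right h1).trans ha
  have hzc := (bruhatLE_mul_left h2).trans hc
  have hbH := hb.mem_parabolic hw.middle_mem
  have he : x * y * b' * (y' * z) = x * (y * b' * y') * z := by simp only [mul_assoc]
  have h3 := cs.length_mul_le (x * (y * b' * y')) z
  have h4 := cs.length_mul_le x (y * b' * y')
  have h5 := cs.length_mul_le (y * b') y'
  have h6 := cs.length_mul_le y b'
  have hsa := support_mono hxa
  have hsc := support_mono hzc
  refine ⟨x, y * b' * y', z, ⟨he, ?_⟩, ⟨hxa.mem_parabolic hw.left_mem.1, hx⟩,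
    (Set.encard_le_encard (Set.inter_subset_inter_left _ hsa)).trans hw.left_card,
    fun α hα => hw.left_commutes α ⟨hsa hα.1, hα.2⟩, mul_mem (mul_mem hy hbH) hy',
    ⟨hzc.mem_parabolic hw.right_mem.1, hz⟩,
    (Set.encard_le_encard (Set.inter_subset_inter_left _ hsc)).trans hw.right_card,
    fun β hβ => hw.right_commutes β ⟨hsc hβ.1, hβ.2⟩⟩
  rw [he] at hl ⊢
  omega

theorem exists_map_eq {u : W} (h : ∃ a b c, 𝒮.IsFactorization u a b c) :
    ∃ a b c, 𝒮.IsFactorization u a b c ∧ 𝒮.map u = a * 𝒮.M b * c := by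
  obtain ⟨a, b, c, habc⟩ := h
  have h : ∃ p : W × W × W, 𝒮.IsFactorization u p.1 p.2.1 p.2.2 := ⟨(a, b, c), habc⟩
  exact ⟨_, _, _, h.choose_spec, by rw [map, dif_pos h]⟩

/-- The value of `𝒮.map` can be computed from any factorization `u = a' * b' * c'` with
`a' ≤ a`, `b' ≤ b`, `c' ≤ c`. -/
theorem IsFactorization.map_eq {u a b c a' b' c' : W} (hw : 𝒮.IsFactorization w a b c)
    (hu : cs.BruhatLE u w) (ha : cs.BruhatLE a' a) (hb : cs.BruhatLE b' b)
    (hc : cs.BruhatLE c' c) (h : u = a' * b' * c') : 𝒮.map u = a' * 𝒮.M b' * c' := by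
  obtain ⟨a₁, b₁, c₁, h₁, hmap⟩ := exists_map_eq (hw.exists_of_le hu)
  rw [hmap]
  -- Each set of letters joins the supports of both factorizations. Each letter in `H` comes from a
  -- factorization with its own commutation condition.
  refine mul_map_mul_eq (A := cs.support a₁ ∪ cs.support a) (C := cs.support c₁ ∪ cs.support c)
    (Set.union_subset h₁.support_left_subset hw.support_left_subset)
    (Set.union_subset h₁.support_right_subset hw.support_right_subset) ?_ ?_
    (parabolic_mono Set.subset_union_left (cs.mem_parabolic_support a₁))
    (parabolic_mono Set.subset_union_right ha.mem_parabolic_support)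
    (h₁.middle_le_longest hu)
    (hb.trans (hw.middle_le_longest (BruhatLE.refl w)))
    (parabolic_mono Set.subset_union_left (cs.mem_parabolic_support c₁))
    (parabolic_mono Set.subset_union_right hc.mem_parabolic_support)
    (h₁.lengthAdditive.1.symm.trans h)
  · rintro i ⟨hi | hi, hiH⟩
    · exact h₁.left_commutes i ⟨hi, hiH⟩
    · exact hw.left_commutes i ⟨hi, hiH⟩
  · rintro i ⟨hi | hi, hiH⟩
    · exact h₁.right_commutes i ⟨hi, hiH⟩
    · exact hw.right_commutes i ⟨hi, hiH⟩

end MatchingSystem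

end CoxeterSystem

theorem mainTheorem3 {B W : Type*} [Group W] {N : CoxeterMatrix B} (cs : CoxeterSystem N W)
    {w : W} (𝒮 : cs.MatchingSystem w) {a b c : W} (hw : 𝒮.IsFactorization w a b c)
    {u : W} (hu : cs.BruhatLE u w) {a' b' c' : W}
    (ha : cs.BruhatLE a' a) (hb : cs.BruhatLE b' b) (hc : cs.BruhatLE c' c) :
    (cs.IsLengthAdditive u a' b' c' → 𝒮.map u = a' * 𝒮.M b' * c') ∧
    (cs.IsSpecialMatching w 𝒮.map → u = a' * b' * c' →
      ∀ r : B, cs.IsLeftDescent a r →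
        cs.IsLengthAdditive (cs.simple r * u) (cs.simple r * a') b' c' →
          𝒮.map u = a' * 𝒮.M b' * c') :=
  ⟨fun h => hw.map_eq hu ha hb hc h.1, fun _ h _ _ _ => hw.map_eq hu ha hb hc h⟩
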